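/- A $Z_2Z_4$-additive code of type $(\alpha,\beta)$ is a subset of $\mathbb Z_2^\alpha\times\mathbb Z_4^\beta$ closed under coordinatewise addition. The Gray map $\Phi:\mathbb Z_2^\alpha\times\mathbb Z_4^\beta\to\{0,1\}^{\alpha+2\beta}$ keeps the $\alpha$ binary coordinates and replaces each quaternary coordinate by two binary ones according to $0\mapsto 00$, $1\mapsto 01$, $2\mapsto 11$, $3\mapsto 10$. A binary code $C\subseteq\{0,1\}^n$ is called $1$-perfect if $|C|=2^n/(n+1)$ and any two distinct codewords are at Hamming distance at least $3$; extended $1$-perfect if $|C|=2^{n-1}/n$ and any two distinct codewords are at distance at least $4$; Preparata-like if $|C|=2^n/n^2$ and any two distinct codewords are at distance at least $6$. Two binary codes are permutation-equivalent if they have the same length and one is obtained from the other by a permutation of coordinates. Two $Z_2Z_4$-additive codes are monomially equivalent if they have the same type $(\alpha,\beta)$ and one is obtained from the other by a monomial transformation, that is, by a permutation of the binary coordinates and a permutation of the quaternary coordinates, followed by sign changes in some quaternary coordinates. **Corollary 3.** Let $\mathcal C$ and $\mathcal D$ be $Z_2Z_4$-additive codes, of types $(\alpha,\beta)$ and $(\alpha',\beta')$,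 such that each of the Gray images $C=\Phi(\mathcal C)$ and $D=\Phi(\mathcal D)$ is a $1$-perfect, extended $1$-perfect, or Preparata-like code, and such that $C$ has length $\alpha+2\beta>16$. If $\mathcal C$ and $\mathcal D$ are not monomially equivalent, then $C$ and $D$ are not permutation-equivalent. -/

import Mathlib

namespace Z2Z4

/-- Binary words of length `n`. -/
abbrev BinWord (n : ℕ) : Type := Fin n → ZMod 2

/-- Words in the mixed alphabet: `α` binary coordinates followed by `β` quaternary ones. -/
abbrev MixedWord (α β : ℕ) : Type := (Fin α → ZMod 2) × (Fin β → ZMod 4)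

/-- A code in the mixed alphabet is additive if it is closed under coordinatewise addition,
modulo 2 in the binary coordinates and modulo 4 in the quaternary ones. -/
def IsAdditive {α β : ℕ} (C : Set (MixedWord α β)) : Prop :=
  ∀ x ∈ C, ∀ y ∈ C, x + y ∈ C

/-- The Gray map on one quaternary symbol: `0 ↦ 00`, `1 ↦ 01`, `2 ↦ 11`, `3 ↦ 10`. -/
def grayDigit : ZMod 4 → Fin 2 → ZMod 2 :=
  ![![0, 0], ![0, 1], ![1, 1], ![1, 0]]

/-- The Gray map. The binary coordinates are kept; the `j`-th quaternary coordinate is replaced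
by the two adjacent binary coordinates with numbers `α + 2 * j` and `α + 2 * j + 1`. -/
def gray {α β : ℕ} (x : MixedWord α β) : BinWord (α + β * 2) :=
  Fin.append x.1 fun k => grayDigit (x.2 k.divNat) k.modNat

/-- Any two distinct codewords are at Hamming distance at least `d`. -/
def HasMinDist {n : ℕ} (C : Set (BinWord n)) (d : ℕ) : Prop :=
  ∀ x ∈ C, ∀ y ∈ C, x ≠ y → d ≤ hammingDist x y

/-- `1`-perfect codes: `|C| = 2 ^ n / (n + 1)` and code distance at least `3`. -/
def IsOnePerfect {n : ℕ} (C : Set (BinWord n)) : Prop :=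
  C.ncard * (n + 1) = 2 ^ n ∧ HasMinDist C 3

/-- Extended `1`-perfect codes: `|C| = 2 ^ (n - 1) / n` and code distance at least `4`. -/
def IsExtendedOnePerfect {n : ℕ} (C : Set (BinWord n)) : Prop :=
  C.ncard * n = 2 ^ (n - 1) ∧ HasMinDist C 4

/-- Preparata-like codes: `|C| = 2 ^ n / n ^ 2` and code distance at least `6`. -/
def IsPreparataLike {n : ℕ} (C : Set (BinWord n)) : Prop :=
  C.ncard * n ^ 2 = 2 ^ n ∧ HasMinDist C 6

/-- The action of a permutation (more generally, bijection) of coordinates on binary words: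
`σ(x)_i = x_{σ⁻¹(i)}`. -/
def permute {m n : ℕ} (σ : Fin m ≃ Fin n) (x : BinWord m) : BinWord n :=
  fun i => x (σ.symm i)

/-- Permutation equivalence of binary codes. Codes of different lengths are never equivalent,
as there is no bijection between their coordinate sets. -/
def PermEquivalent {m n : ℕ} (C : Set (BinWord m)) (D : Set (BinWord n)) : Prop :=
  ∃ σ : Fin m ≃ Fin n, permute σ '' C = D

/-- Monomial transformations: a permutation `ρ` of the binary coordinates and a permutation `τ`
of the quaternary ones, followed by the sign changes `ε` in the quaternary coordinates. -/
def monomial {α β α' β' : ℕ} (ρ : Fin α ≃ Fin α') (τ : Fin β ≃ Fin β') (ε : Fin β' → ℤˣ)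
    (x : MixedWord α β) : MixedWord α' β' :=
  (fun i => x.1 (ρ.symm i), fun j => ε j • x.2 (τ.symm j))

/-- Monomial equivalence of codes in the mixed alphabet. Codes of different types `(α, β)` are
never equivalent. -/
def MonomiallyEquivalent {α β α' β' : ℕ} (C : Set (MixedWord α β)) (D : Set (MixedWord α' β')) :
    Prop :=
  ∃ (ρ : Fin α ≃ Fin α') (τ : Fin β ≃ Fin β') (ε : Fin β' → ℤˣ), monomial ρ τ ε '' C = D

end Z2Z4

namespace Z2Z4

/-! ### Packings of finite sets, perfect and extended perfect families. -/

section SetFamilies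

open Finset

variable {ι : Type*} [DecidableEq ι]

/-! A binary word that is a Gray image remembers its additive structure through an involution `m` of
the coordinates, which fixes the binary ones and swaps the two bits of each quaternary one: addition
becomes `twistedAdd m`, the usual sum plus a correction quadratic in the words (`gray_add`). A
coordinate bijection taking one Gray image to the other pulls the second involution back to the
first code, which is then closed under two twisted additions.

These must coincide (`involution_unique`). If `m a ≠ m' a`, take codewords `x`, `y` that both
contain `a` but otherwise avoid each other and each other's partners. The two twisted sums then
differ exactly at `m a` and `m' a`, so two codewords are at distance 2, although the minimum
distance is at least 3. Hence the bijection respects the pairing of coordinates, and such a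
bijection is monomial (`monomiallyEquivalent_of_partner`).

The codewords `x`, `y` come from `exists_light_codeword`: the optimal cardinality of each kind of
code forces many codewords of weight at most 3, 4 or 6 through every coordinate, too many for a
small set to meet them all. This is where length above 16 enters. -/

theorem card_symmDiff_add_two_mul_card_inter (s t : Finset ι) :
    #(symmDiff s t) + 2 * #(s ∩ t) = #s + #t := by
  have h1 := card_sdiff_add_card_inter s t
  have h2 := card_sdiff_add_card_inter t s
  have h3 : #(symmDiff s t) = #(s \ t) + #(t \ s) :=
    card_union_of_disjoint disjoint_sdiff_sdiff
  rw [inter_comm t s] at h2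
  omega

theorem card_symmDiff_le_add (s t : Finset ι) : #(symmDiff s t) ≤ #s + #t := by
  have := card_symmDiff_add_two_mul_card_inter s t
  omega

/-- Any two distinct members of `E` have symmetric difference of cardinality at least `d`. -/
def FamilyDist (E : Finset (Finset ι)) (d : ℕ) : Prop :=
  ∀ s ∈ E, ∀ t ∈ E, s ≠ t → d ≤ #(symmDiff s t)

theorem FamilyDist.eq_of_lt {E : Finset (Finset ι)} {d : ℕ} (h : FamilyDist E d)
    {s t : Finset ι} (hs : s ∈ E) (ht : t ∈ E) (hst : #(symmDiff s t) < d) : s = t := by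
  by_contra hne
  exact absurd (h s hs t ht hne) (by omega)

theorem FamilyDist.le_card {E : Finset (Finset ι)} {d : ℕ} (h : FamilyDist E d)
    (h0 : ∅ ∈ E) {s : Finset ι} (hs : s ∈ E) (hne : s.Nonempty) : d ≤ #s := by
  have := h s hs ∅ h0 hne.ne_empty
  simpa [symmDiff] using this

variable [Fintype ι]

/-- A family meeting the sphere-packing bound for distance `3` covers everything. -/
theorem exists_near_of_perfect {E : Finset (Finset ι)}
    (hc : #E * (Fintype.card ι + 1) = 2 ^ Fintype.card ι) (hd : FamilyDist E 3)
    (v : Finset ι) : ∃ c ∈ E, #(symmDiff c v) ≤ 1 := by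
  let f : E × Option ι → Finset ι := fun p => symmDiff p.1.1 (p.2.elim ∅ singleton)
  have hle : ∀ o : Option ι, #(o.elim (∅ : Finset ι) singleton) ≤ 1 := by
    rintro (_ | i) <;> simp
  have hf : Function.Injective f := by
    rintro ⟨⟨c, hcE⟩, o⟩ ⟨⟨c', hcE'⟩, o'⟩ h
    simp only [f] at h
    have h1 : symmDiff c c' = symmDiff (o.elim ∅ singleton) (o'.elim ∅ singleton) := by
      have h2 := congrArg (fun x => symmDiff (symmDiff c' x) (o.elim ∅ singleton)) h
      simp only [symmDiff_symmDiff_cancel_left] at h2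
      rw [← symmDiff_assoc, symmDiff_symmDiff_cancel_right, symmDiff_comm c' c] at h2
      rw [h2, symmDiff_comm]
    have h3 : c = c' := hd.eq_of_lt hcE hcE' (by
      rw [h1]
      have := card_symmDiff_le_add (o.elim (∅ : Finset ι) singleton) (o'.elim ∅ singleton)
      have := hle o
      have := hle o'
      omega)
    subst h3
    have h4 : o.elim (∅ : Finset ι) singleton = o'.elim ∅ singleton :=
      symmDiff_right_injective c h
    rcases o with _ | i <;> rcases o' with _ | j
    · rfl
    · simp at h4
    · simp at h4
    · simp at h4; simp [h4]
  have hb : Function.Bijective f := (Fintype.bijective_iff_injective_and_card f).2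
    ⟨hf, by simp [hc]⟩
  obtain ⟨⟨⟨c, hcE⟩, o⟩, rfl⟩ := hb.2 v
  exact ⟨c, hcE, by simpa [f] using hle o⟩

/-- A family meeting the bound for distance `4` covers everything up to one coordinate. -/
theorem exists_near_of_extended_perfect {E : Finset (Finset ι)}
    (hc : #E * Fintype.card ι = 2 ^ (Fintype.card ι - 1)) (hd : FamilyDist E 4)
    (a : ι) (v : Finset ι) : ∃ c ∈ E, ∃ i, symmDiff c v ⊆ {i, a} := by
  -- Puncture at `a`: `i` runs over the ball of radius 1 around the punctured member (`i = a` stands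
  -- for its centre), and the Boolean restores an arbitrary bit at `a`.
  let f : E × ι × Bool → Finset ι :=
    fun p => symmDiff (p.1.1 \ {a}) (symmDiff ({p.2.1} \ {a}) (bif p.2.2 then {a} else ∅))
  have key : ∀ p, symmDiff p.1.1 (f p) ⊆ {p.2.1, a} := by
    rintro ⟨⟨c, hcE⟩, i, b⟩ x
    simp only [f, mem_symmDiff, mem_sdiff, mem_singleton, mem_insert]
    by_cases hx : x = a
    · simp [hx]
    · cases b <;> simp [hx] <;> tauto
  have hf : Function.Injective f := by
    rintro ⟨⟨c, hcE⟩, i, b⟩ ⟨⟨c', hcE'⟩, j, b'⟩ h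
    have h1 : symmDiff c c' ⊆ {i, j, a} := by
      have h2 := key ⟨⟨c, hcE⟩, i, b⟩
      have h3 := key ⟨⟨c', hcE'⟩, j, b'⟩
      rw [← h] at h3
      refine (symmDiff_triangle c (f ⟨⟨c, hcE⟩, i, b⟩) c').trans ?_
      rw [symmDiff_comm _ c']
      intro x hx
      rcases mem_union.1 hx with hx | hx
      · have := h2 hx; simp at this ⊢; tauto
      · have := h3 hx; simp at this ⊢; tauto
    have h3 : c = c' := hd.eq_of_lt hcE hcE'
      (lt_of_le_of_lt ((card_le_card h1).trans card_le_three) (by norm_num))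
    subst h3
    have h4 : symmDiff ({i} \ {a}) (bif b then {a} else ∅) =
        symmDiff ({j} \ {a}) (bif b' then {a} else ∅) := symmDiff_right_injective _ h
    have hb : b = b' := by
      have := Finset.ext_iff.1 h4 a
      cases b <;> cases b' <;> simp [mem_symmDiff] at this ⊢
    subst hb
    have hij : ({i} : Finset ι) \ {a} = {j} \ {a} := symmDiff_left_injective _ h4
    have : i = j := by
      have h6 := Finset.ext_iff.1 hij i
      have h7 := Finset.ext_iff.1 hij j
      simp only [mem_sdiff, mem_singleton] at h6 h7
      grind
    rw [this]
  have hpos : 0 < Fintype.card ι := Fintype.card_pos_iff.2 ⟨a⟩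
  have hb : Function.Bijective f := (Fintype.bijective_iff_injective_and_card f).2
    ⟨hf, by
      simp only [Fintype.card_prod, Fintype.card_coe, Fintype.card_bool, Fintype.card_finset]
      rw [← mul_assoc, hc, ← pow_succ, Nat.sub_add_cancel hpos]⟩
  obtain ⟨⟨⟨c, hcE⟩, i, b⟩, hv⟩ := hb.2 v
  exact ⟨c, hcE, i, by simpa [hv] using key ⟨⟨c, hcE⟩, i, b⟩⟩

/-- Every pair `{a, t}` extends to a triple `{a, t, z t}` in `E`. If all light members through `a`
met `F`, then `z` would inject the complement of `insert a F` into `F`, forcing at most 2 · 8 + 1 =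
17 points. -/
theorem exists_light_of_perfect {E : Finset (Finset ι)}
    (hc : #E * (Fintype.card ι + 1) = 2 ^ Fintype.card ι) (hd : FamilyDist E 3)
    (h0 : ∅ ∈ E) (hn : 16 < Fintype.card ι) (a : ι) (F : Finset ι) (haF : a ∉ F)
    (hF : #F ≤ 8) : ∃ c ∈ E, a ∈ c ∧ Disjoint c F ∧ #c ≤ 3 := by
  -- Length 17 is impossible, because 18 does not divide a power of two.
  have h17 : 17 < Fintype.card ι := by
    by_contra h
    have : Fintype.card ι = 17 := by omega
    rw [this] at hc
    omega
  by_contra! hno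
  have hz : ∀ t, t ≠ a → ∃ z, z ≠ a ∧ z ≠ t ∧ ({a, t, z} : Finset ι) ∈ E := by
    intro t hta
    obtain ⟨c, hcE, hct⟩ := exists_near_of_perfect hc hd {a, t}
    have hcard := card_symmDiff_add_two_mul_card_inter c {a, t}
    rw [card_pair hta.symm] at hcard
    have h2 : #(c ∩ {a, t}) ≤ 2 := (card_le_card inter_subset_right).trans card_le_two
    have hc3 : 3 ≤ #c := hd.le_card h0 hcE (by
      rw [nonempty_iff_ne_empty]
      rintro rfl
      simp at hcard
      omega)
    have hsub : {a, t} ⊆ c := by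
      rw [← inter_eq_right]
      exact eq_of_subset_of_card_le inter_subset_right (by rw [card_pair hta.symm]; omega)
    have h1 : #(c \ {a, t}) = 1 := by
      rw [card_sdiff_of_subset hsub, card_pair hta.symm]; omega
    obtain ⟨z, hz⟩ := card_eq_one.1 h1
    have hzm : z ∈ c \ {a, t} := by simp [hz]
    simp only [mem_sdiff, mem_insert, mem_singleton, not_or] at hzm
    refine ⟨z, hzm.2.1, hzm.2.2, ?_⟩
    have : c = {a, t, z} := by
      rw [← sdiff_union_of_subset hsub, hz]
      ext x; simp; tauto
    rwa [← this]
  choose! z hza hzt hzE using hz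
  have hmap : ∀ t ∈ (univ \ insert a F), z t ∈ F := by
    intro t ht
    simp only [mem_sdiff, mem_univ, true_and, mem_insert, not_or] at ht
    by_contra hzF
    have := hno _ (hzE t ht.1) (by simp) (by
      rw [disjoint_left]; intro x hx; simp at hx
      rcases hx with rfl | rfl | rfl
      · exact haF
      · exact ht.2
      · exact hzF)
    exact absurd (card_le_three (a := a) (b := t) (c := z t)) (by omega)
  have hinj : Set.InjOn z (univ \ insert a F : Finset ι) := by
    intro t ht t' ht' h
    simp only [coe_sdiff, coe_univ, Set.mem_sdiff, Set.mem_univ, true_and, mem_coe, mem_insert,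
      not_or] at ht ht'
    by_contra hne
    have h1 := hd _ (hzE t ht.1) _ (hzE t' ht'.1) (fun h' => by
      have : t ∈ ({a, t', z t'} : Finset ι) := by rw [← h']; simp
      simp only [mem_insert, mem_singleton] at this
      rcases this with h' | h' | h'
      · exact ht.1 h'
      · exact hne h'
      · exact hzt t ht.1 (h.trans h'.symm))
    have h2 : symmDiff ({a, t, z t} : Finset ι) {a, t', z t'} ⊆ {t, t'} := by
      intro x; simp only [mem_symmDiff, mem_insert, mem_singleton, h]; tauto
    have := (card_le_card h2).trans card_le_two
    omega
  have h1 := card_le_card_of_injOn z hmap hinj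
  rw [card_sdiff_of_subset (subset_univ _), card_univ, card_insert_of_notMem haF] at h1
  omega

/-- The same injection, with quadruples `{a, s, t, z t}` for a fixed `s` outside `F`, would force at
most 2 · 11 + 2 = 24 points. The length divides a power of two, so it exceeds 24. -/
theorem exists_light_of_extended_perfect {E : Finset (Finset ι)}
    (hc : #E * Fintype.card ι = 2 ^ (Fintype.card ι - 1)) (hd : FamilyDist E 4)
    (h0 : ∅ ∈ E) (hn : 16 < Fintype.card ι) (a : ι) (F : Finset ι) (haF : a ∉ F)
    (hF : #F ≤ 11) : ∃ c ∈ E, a ∈ c ∧ Disjoint c F ∧ #c ≤ 4 := by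
  have h24 : 24 < Fintype.card ι := by
    by_contra h
    have hdvd : Fintype.card ι ∣ 2 ^ (Fintype.card ι - 1) := ⟨_, by rw [← hc, mul_comm]⟩
    generalize Fintype.card ι = n at *
    interval_cases n <;> revert hdvd <;> decide
  by_contra! hno
  obtain ⟨s, hs⟩ : ∃ s, s ∉ insert a F := by
    by_contra! h
    have := card_le_card (s := univ) (t := insert a F) (fun x _ => h x)
    rw [card_univ, card_insert_of_notMem haF] at this
    omega
  simp only [mem_insert, not_or] at hs
  have hz : ∀ t, t ≠ a ∧ t ≠ s →
      ∃ z, z ≠ a ∧ z ≠ s ∧ z ≠ t ∧ ({a, s, t, z} : Finset ι) ∈ E := by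
    rintro t ⟨hta, hts⟩
    obtain ⟨c, hcE, i, hct⟩ := exists_near_of_extended_perfect hc hd a {s, t}
    have hcard := card_symmDiff_add_two_mul_card_inter c {s, t}
    rw [card_pair hts.symm] at hcard
    have h2 : #(c ∩ {s, t}) ≤ 2 := (card_le_card inter_subset_right).trans card_le_two
    have h3 := (card_le_card hct).trans card_le_two
    have hc4 : 4 ≤ #c := hd.le_card h0 hcE (by
      rw [nonempty_iff_ne_empty]
      rintro rfl
      have h4 : ∀ x, x = s ∨ x = t → x = i ∨ x = a := by
        intro x hx
        have := @hct x (by simp [mem_symmDiff, hx])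
        simpa using this
      have := h4 s (Or.inl rfl)
      have := h4 t (Or.inr rfl)
      have := hs.1
      grind)
    have hsub : {s, t} ⊆ c := by
      rw [← inter_eq_right]
      exact eq_of_subset_of_card_le inter_subset_right (by rw [card_pair hts.symm]; omega)
    have heq : symmDiff c {s, t} = {i, a} := eq_of_subset_of_card_le hct
      (by have := card_le_two (a := i) (b := a); omega)
    have heq' : c \ {s, t} = {i, a} := by
      rw [← heq, symmDiff_def, sdiff_eq_empty_iff_subset.2 hsub]; simp
    have hia : i ≠ a := by
      rintro rfl
      have := congrArg card heq
      simp at this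
      omega
    have him : i ∈ c \ {s, t} := by simp [heq']
    simp only [mem_sdiff, mem_insert, mem_singleton, not_or] at him
    refine ⟨i, hia, him.2.1, him.2.2, ?_⟩
    have : c = {a, s, t, i} := by
      rw [← sdiff_union_of_subset hsub, heq']
      ext x; simp; tauto
    rwa [← this]
  choose! z hza hzs hzt hzE using hz
  have hmap : ∀ t ∈ (univ \ insert s (insert a F)), z t ∈ F := by
    intro t ht
    simp only [mem_sdiff, mem_univ, true_and, mem_insert, not_or] at ht
    by_contra hzF
    have := hno _ (hzE t ⟨ht.2.1, ht.1⟩) (by simp) (by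
      rw [disjoint_left]; intro x hx; simp at hx
      rcases hx with rfl | rfl | rfl | rfl
      · exact haF
      · exact hs.2
      · exact ht.2.2
      · exact hzF)
    exact absurd (card_le_four (a := a) (b := s) (c := t) (d := z t)) (by omega)
  have hinj : Set.InjOn z (univ \ insert s (insert a F) : Finset ι) := by
    intro t ht t' ht' h
    simp only [coe_sdiff, coe_univ, Set.mem_sdiff, Set.mem_univ, true_and, mem_coe, mem_insert,
      not_or] at ht ht'
    by_contra hne
    have h1 := hd _ (hzE t ⟨ht.2.1, ht.1⟩) _ (hzE t' ⟨ht'.2.1, ht'.1⟩) (fun h' => by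
      have : t ∈ ({a, s, t', z t'} : Finset ι) := by rw [← h']; simp
      simp only [mem_insert, mem_singleton] at this
      rcases this with h' | h' | h' | h'
      · exact ht.2.1 h'
      · exact ht.1 h'
      · exact hne h'
      · exact hzt t ⟨ht.2.1, ht.1⟩ (h.trans h'.symm))
    have h2 : symmDiff ({a, s, t, z t} : Finset ι) {a, s, t', z t'} ⊆ {t, t'} := by
      intro x; simp only [mem_symmDiff, mem_insert, mem_singleton, h]; tauto
    have := (card_le_card h2).trans card_le_two
    omega
  have h1 := card_le_card_of_injOn z hmap hinj
  rw [card_sdiff_of_subset (subset_univ _), card_univ, card_insert_of_notMem,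
    card_insert_of_notMem haF] at h1
  · omega
  · simp [hs]

end SetFamilies
-- Preparata-like families: counting members near a given set.
section Preparata

open Finset

variable {ι : Type*} [DecidableEq ι]

theorem symmDiff_of_common (v s t : Finset ι) :
    symmDiff (symmDiff v s) (symmDiff v t) = symmDiff s t := by
  rw [symmDiff_symmDiff_symmDiff_comm, symmDiff_self, bot_symmDiff]

theorem symmDiff_of_common_flip (v s t : Finset ι) (a : ι) :
    symmDiff (symmDiff v s) (symmDiff (symmDiff v {a}) t) = symmDiff (symmDiff s t) {a} := by
  rw [symmDiff_assoc v {a} t, symmDiff_of_common, symmDiff_comm {a} t, ← symmDiff_assoc]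

theorem card_symmDiff_singleton (s : Finset ι) (a : ι) :
    #(symmDiff s {a}) + 2 * (if a ∈ s then 1 else 0) = #s + 1 := by
  have := card_symmDiff_add_two_mul_card_inter s {a}
  rw [card_singleton] at this
  rw [← this]
  split_ifs with h <;> simp [h]

theorem disjoint_of_card_symmDiff {s t : Finset ι} (hs : #s = 3) (ht : #t = 3)
    (h : 6 ≤ #(symmDiff s t)) : Disjoint s t := by
  have := card_symmDiff_add_two_mul_card_inter s t
  rw [disjoint_iff_inter_eq_empty, ← card_eq_zero]
  omega

variable [Fintype ι]

/-- The `j`-subsets leading from `v` to a member of `E`. -/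
def shell (E : Finset (Finset ι)) (j : ℕ) (v : Finset ι) : Finset (Finset ι) :=
  (powersetCard j univ).filter fun s => symmDiff v s ∈ E

theorem mem_shell {E : Finset (Finset ι)} {j : ℕ} {v s : Finset ι} :
    s ∈ shell E j v ↔ #s = j ∧ symmDiff v s ∈ E := by
  simp [shell]

theorem sum_card_shell (E : Finset (Finset ι)) (j : ℕ) :
    ∑ v, #(shell E j v) = (Fintype.card ι).choose j * #E := by
  simp only [shell, card_filter]
  rw [sum_comm]
  have : ∀ s : Finset ι, ∑ v : Finset ι, (if symmDiff v s ∈ E then 1 else 0) = #E := by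
    intro s
    rw [← card_filter]
    refine card_bij (fun v _ => symmDiff v s) (by simp) ?_ ?_
    · intro v _ w _ h
      exact symmDiff_left_injective s h
    · intro c hc
      exact ⟨symmDiff c s, by simpa using hc, by simp⟩
  simp [this, card_powersetCard]

variable {E : Finset (Finset ι)}

theorem le_card_symmDiff_of_mem_shell (hd : FamilyDist E 6) {j k : ℕ} {v s t : Finset ι}
    (hs : s ∈ shell E j v) (ht : t ∈ shell E k v) (hne : s ≠ t) : 6 ≤ #(symmDiff s t) := by
  rw [mem_shell] at hs ht
  rw [← symmDiff_of_common v]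
  exact hd _ hs.2 _ ht.2 fun h => hne (symmDiff_right_injective v h)

/-- Two odd shells around neighbouring centres are far apart. -/
theorem six_le_card_symmDiff_of_mem_shell_flip (hd : FamilyDist E 6) {j k : ℕ} {v s t : Finset ι} {a : ι}
    (hs : s ∈ shell E j v) (ht : t ∈ shell E k (symmDiff v {a})) (hj : Odd j) (hk : Odd k) :
    6 ≤ #(symmDiff s t) ∧ (#(symmDiff s t) = 6 → a ∉ symmDiff s t) := by
  rw [mem_shell] at hs ht
  have h1 := card_symmDiff_add_two_mul_card_inter s t
  have h2 := card_symmDiff_singleton (symmDiff s t) a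
  obtain ⟨j', rfl⟩ := hj
  obtain ⟨k', rfl⟩ := hk
  have h3 := hd _ hs.2 _ ht.2 (fun h => by
    have h4 := symmDiff_of_common_flip v s t a
    rw [← h, symmDiff_self] at h4
    rw [← h4] at h2
    simp only [bot_eq_empty, card_empty] at h2
    split_ifs at h2 <;> omega)
  rw [symmDiff_of_common_flip] at h3
  -- Both shells being odd, `symmDiff s t` has even cardinality. Toggling `a` changes the
  -- cardinality by one, so the bound 6 after toggling improves to 7 by parity.
  split_ifs at h2 with h
  · exact ⟨by omega, fun h6 => by omega⟩
  · exact ⟨by omega, fun _ => h⟩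

theorem disjoint_shells_flip (hd : FamilyDist E 6) (v : Finset ι) (a : ι) :
    Disjoint (shell E 3 v) (shell E 3 (symmDiff v {a})) := by
  rw [disjoint_left]
  intro s hs ht
  have := (six_le_card_symmDiff_of_mem_shell_flip hd hs ht (by decide) (by decide)).1
  simp at this

/-- The weighted number of members of `E` near `v`. -/
def nearWeight (E : Finset (Finset ι)) (v : Finset ι) : ℕ :=
  (Fintype.card ι - 1) * #(shell E 1 v) + 3 * #(shell E 3 v)

theorem three_mul_card_shells_le (hd : FamilyDist E 6) (v : Finset ι) (a : ι) :
    3 * (#(shell E 3 v) + #(shell E 3 (symmDiff v {a}))) ≤ Fintype.card ι := by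
  rw [← card_union_of_disjoint (disjoint_shells_flip hd v a), mul_comm, ← card_univ]
  rw [← sum_const_nat (f := fun s : Finset ι => #s)
    (s := shell E 3 v ∪ shell E 3 (symmDiff v {a}))]
  · rw [← card_biUnion]
    · exact card_le_card (subset_univ _)
    · intro s hs t ht hne
      have hs3 : #s = 3 := by
        rcases mem_union.1 hs with h | h <;> exact (mem_shell.1 h).1
      have ht3 : #t = 3 := by
        rcases mem_union.1 ht with h | h <;> exact (mem_shell.1 h).1
      refine disjoint_of_card_symmDiff hs3 ht3 ?_
      rcases mem_union.1 hs with h | h <;> rcases mem_union.1 ht with h' | h'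
      · exact le_card_symmDiff_of_mem_shell hd h h' hne
      · exact (six_le_card_symmDiff_of_mem_shell_flip hd h h' (by decide) (by decide)).1
      · rw [symmDiff_comm]
        exact (six_le_card_symmDiff_of_mem_shell_flip hd h' h (by decide) (by decide)).1
      · exact le_card_symmDiff_of_mem_shell hd h h' hne
  · intro s hs
    rcases mem_union.1 hs with h | h <;> exact (mem_shell.1 h).1

theorem shells_of_one_nonempty (hd : FamilyDist E 6) {v : Finset ι} (a : ι)
    (h : (shell E 1 v).Nonempty) : #(shell E 1 v) = 1 ∧ #(shell E 3 v) = 0 ∧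
      #(shell E 1 (symmDiff v {a})) = 0 ∧ #(shell E 3 (symmDiff v {a})) = 0 := by
  obtain ⟨s, hs⟩ := h
  have hs1 := (mem_shell.1 hs).1
  have small : ∀ t : Finset ι, #t ≤ 3 → #(symmDiff s t) < 6 := fun t ht => by
    have := card_symmDiff_le_add s t
    omega
  refine ⟨card_eq_one.2 ⟨s, ?_⟩, ?_, ?_, ?_⟩
  · rw [eq_singleton_iff_unique_mem]
    refine ⟨hs, fun t ht => ?_⟩
    by_contra hne
    have := le_card_symmDiff_of_mem_shell hd hs ht (Ne.symm hne)
    have := small t (by rw [(mem_shell.1 ht).1]; omega)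
    omega
  · rw [card_eq_zero, eq_empty_iff_forall_notMem]
    intro t ht
    have h3 := (mem_shell.1 ht).1
    have := le_card_symmDiff_of_mem_shell hd hs ht (by rintro rfl; omega)
    have := small t h3.le
    omega
  · rw [card_eq_zero, eq_empty_iff_forall_notMem]
    intro t ht
    have h3 := (mem_shell.1 ht).1
    have := (six_le_card_symmDiff_of_mem_shell_flip hd hs ht (by decide) (by decide)).1
    have := small t (by omega)
    omega
  · rw [card_eq_zero, eq_empty_iff_forall_notMem]
    intro t ht
    have h3 := (mem_shell.1 ht).1
    have := (six_le_card_symmDiff_of_mem_shell_flip hd hs ht (by decide) (by decide)).1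
    have := small t (by omega)
    omega

/-- A nonempty 1-shell empties the other shells and contributes the full bound alone. Otherwise the
triples in the two 3-shells are pairwise disjoint, so they cover at most `Fintype.card ι` points;
that number is not a multiple of 3, which saves one. -/
theorem nearWeight_add_le (hd : FamilyDist E 6) (h3 : ¬ 3 ∣ Fintype.card ι) (v : Finset ι)
    (a : ι) : nearWeight E v + nearWeight E (symmDiff v {a}) ≤ Fintype.card ι - 1 := by
  unfold nearWeight
  rcases (shell E 1 v).eq_empty_or_nonempty with h | h
  · rcases (shell E 1 (symmDiff v {a})).eq_empty_or_nonempty with h' | h'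
    · have := three_mul_card_shells_le hd v a
      rw [h, h']
      simp only [card_empty, mul_zero, zero_add]
      omega
    · have := shells_of_one_nonempty hd a h'
      rw [symmDiff_symmDiff_cancel_right] at this
      simp [this]
  · have := shells_of_one_nonempty hd a h
    simp [this]

theorem six_mul_choose_three (n : ℕ) : 6 * (n + 2).choose 3 = (n + 2) * (n + 1) * n := by
  have h := Nat.descFactorial_eq_factorial_mul_choose (n + 2) 3
  simp only [Nat.descFactorial, Nat.factorial] at h
  have e1 : n + 2 - 0 = n + 2 := rfl
  have e2 : n + 2 - 1 = n + 1 := rfl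
  have e3 : n + 2 - 2 = n := rfl
  rw [e1, e2, e3] at h
  linarith

/-- Double counting shows that the sum over all `v` attains the total of the pointwise upper bounds,
so every one of them is an equality. -/
theorem nearWeight_add_eq (hc : #E * Fintype.card ι ^ 2 = 2 ^ Fintype.card ι)
    (hd : FamilyDist E 6) (h3 : ¬ 3 ∣ Fintype.card ι) (h2 : 2 ≤ Fintype.card ι) (v : Finset ι)
    (a : ι) : nearWeight E v + nearWeight E (symmDiff v {a}) = Fintype.card ι - 1 := by
  have hsum : ∑ v, nearWeight E (symmDiff v {a}) = ∑ v, nearWeight E v :=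
    (show Function.Involutive fun v : Finset ι => symmDiff v {a} from
      fun v => symmDiff_symmDiff_cancel_right _ _).bijective.sum_comp (nearWeight E)
  have htot : ∑ v, nearWeight E v =
      ((Fintype.card ι - 1) * Fintype.card ι + 3 * (Fintype.card ι).choose 3) * #E := by
    simp only [nearWeight, sum_add_distrib, ← mul_sum, sum_card_shell, Nat.choose_one_right]
    ring
  have heq : ∑ v, (nearWeight E v + nearWeight E (symmDiff v {a})) =
      ∑ _v : Finset ι, (Fintype.card ι - 1) := by
    rw [sum_add_distrib, hsum, htot, sum_const, card_univ, Fintype.card_finset, ← hc]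
    obtain ⟨k, hk⟩ := Nat.exists_eq_add_of_le' h2
    rw [hk]
    have := six_mul_choose_three k
    have e2 : k + 2 - 1 = k + 1 := rfl
    rw [e2, smul_eq_mul]
    linear_combination #E * this
  exact (sum_eq_sum_iff_of_le fun v _ => nearWeight_add_le hd h3 v a).1 heq v (mem_univ v)

/-- Centre at a triple `v` through `a` outside `F`. Since `∅ ∈ E`, `v` lies in its own 3-shell, and
equality in the weight bound gives (n - 1) / 3 disjoint triples there. Each triple `u` other than
`v` yields the 6-element member `symmDiff v u` through `a`. If each had to meet `F`, then (n - 1) /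
3 - 1 ≤ 17, so n ≤ 55. -/
theorem exists_light_of_preparata (hc : #E * Fintype.card ι ^ 2 = 2 ^ Fintype.card ι)
    (hd : FamilyDist E 6) (h0 : ∅ ∈ E) (hn : 16 < Fintype.card ι) (a : ι) (F : Finset ι)
    (haF : a ∉ F) (hF : #F ≤ 17) : ∃ c ∈ E, a ∈ c ∧ Disjoint c F ∧ #c ≤ 6 := by
  obtain ⟨k, -, hk⟩ : ∃ k ≤ Fintype.card ι, Fintype.card ι = 2 ^ k :=
    (Nat.dvd_prime_pow Nat.prime_two).1
      (dvd_trans (dvd_pow_self _ two_ne_zero) ⟨_, by rw [← hc, mul_comm]⟩)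
  have h3 : ¬ 3 ∣ Fintype.card ι := fun h => by
    rw [hk] at h
    have := Nat.prime_three.dvd_of_dvd_pow h
    omega
  -- Length 32 escapes the bound 55, but is excluded at the end because 3 does not divide 31.
  have hrange : Fintype.card ι = 32 ∨ 55 < Fintype.card ι := by
    have h4 : 4 < k := by
      by_contra! h
      have := Nat.pow_le_pow_right (n := 2) (by norm_num) h
      omega
    rcases Nat.lt_or_ge 5 k with h | h
    · have := Nat.pow_le_pow_right (n := 2) (by norm_num) (show 6 ≤ k from h)
      omega
    · have : k = 5 := by omega
      subst this
      exact Or.inl hk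
  by_contra! hno
  obtain ⟨s, hs⟩ : ∃ s, s ∉ insert a F := by
    by_contra! h
    have := card_le_card (s := univ) (t := insert a F) (fun x _ => h x)
    rw [card_univ, card_insert_of_notMem haF] at this
    omega
  obtain ⟨t, ht⟩ : ∃ t, t ∉ insert s (insert a F) := by
    by_contra! h
    have := card_le_card (s := univ) (t := insert s (insert a F)) (fun x _ => h x)
    rw [card_univ, card_insert_of_notMem hs, card_insert_of_notMem haF] at this
    omega
  simp only [mem_insert, not_or] at hs ht
  set v : Finset ι := {a, s, t} with hv
  have hv3 : #v = 3 := card_eq_three.2 ⟨a, s, t, Ne.symm hs.1, Ne.symm ht.2.1, Ne.symm ht.1, rfl⟩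
  have hvF : Disjoint v F := by
    rw [disjoint_left]; intro x hx
    simp only [hv, mem_insert, mem_singleton] at hx
    rcases hx with rfl | rfl | rfl
    · exact haF
    · exact hs.2
    · exact ht.2.2
  have hvm : v ∈ shell E 3 v := mem_shell.2 ⟨hv3, by simpa using h0⟩
  have hB1 : shell E 1 v = ∅ := by
    by_contra h
    have := (shells_of_one_nonempty hd a (nonempty_iff_ne_empty.2 h)).2.1
    rw [card_eq_zero] at this
    simp [this] at hvm
  have hB1' : shell E 1 (symmDiff v {a}) = ∅ := by
    by_contra h
    have := (shells_of_one_nonempty hd a (nonempty_iff_ne_empty.2 h)).2.2.2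
    rw [symmDiff_symmDiff_cancel_right, card_eq_zero] at this
    simp [this] at hvm
  -- Such a triple would be disjoint from `v`, hence at distance exactly 6 from it with `a` in the
  -- difference, which is the excluded equality case.
  have hB3' : shell E 3 (symmDiff v {a}) = ∅ := by
    rw [eq_empty_iff_forall_notMem]
    intro u hu
    have hu3 := (mem_shell.1 hu).1
    obtain ⟨h6, hau⟩ := six_le_card_symmDiff_of_mem_shell_flip hd hvm hu (by decide) (by decide)
    have hdis := disjoint_of_card_symmDiff hv3 hu3 h6
    have := card_symmDiff_add_two_mul_card_inter v u
    refine hau (by omega) (mem_symmDiff.2 (Or.inl ⟨by simp [hv], ?_⟩))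
    exact disjoint_left.1 hdis (by simp [hv])
  have hB3 := nearWeight_add_eq hc hd h3 (by omega) v a
  simp only [nearWeight, hB1, hB1', hB3', card_empty, mul_zero, add_zero, zero_add] at hB3
  have hex : ∀ u ∈ (shell E 3 v).erase v, ∃ x ∈ F, x ∈ u := by
    intro u hu
    obtain ⟨hne, hu⟩ := mem_erase.1 hu
    have hu3 := mem_shell.1 hu
    have hdis := disjoint_of_card_symmDiff hv3 hu3.1
      (le_card_symmDiff_of_mem_shell hd hvm hu (Ne.symm hne))
    by_contra! hx
    have h6 := card_symmDiff_le_add v u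
    refine absurd (hno _ hu3.2 (mem_symmDiff.2 (Or.inl ⟨by simp [hv], ?_⟩)) ?_) (by omega)
    · exact disjoint_left.1 hdis (by simp [hv])
    · rw [disjoint_left]
      intro x hxm hxF
      rcases mem_symmDiff.1 hxm with h | h
      · exact disjoint_left.1 hvF h.1 hxF
      · exact hx x hxF h.1
  have : Nonempty ι := ⟨a⟩
  choose! g hgF hg using hex
  have hinj : Set.InjOn g ((shell E 3 v).erase v : Finset (Finset ι)) := by
    intro u hu u' hu' h
    rw [mem_coe] at hu hu'
    by_contra hne
    have h1 := (mem_erase.1 hu).2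
    have h2 := (mem_erase.1 hu').2
    exact disjoint_left.1 (disjoint_of_card_symmDiff (mem_shell.1 h1).1 (mem_shell.1 h2).1
      (le_card_symmDiff_of_mem_shell hd h1 h2 hne)) (hg u hu) (h ▸ hg u' hu')
  have hle := card_le_card_of_injOn g hgF hinj
  rw [card_erase_of_mem hvm] at hle
  omega

end Preparata
-- Gray coordinates and the transported addition.
/-- The involution that fixes the binary coordinates and exchanges the two binary coordinates
replacing a quaternary one. -/
def partner (α β : ℕ) : Fin (α + β * 2) → Fin (α + β * 2) :=
  Fin.append (fun i => Fin.castAdd (β * 2) i)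
    (fun k => Fin.natAdd α (finProdFinEquiv (k.divNat, k.modNat + 1)))

/-- The position of the `r`-th binary coordinate replacing the `j`-th quaternary one. -/
def quatPos {α β : ℕ} (j : Fin β) (r : Fin 2) : Fin (α + β * 2) :=
  Fin.natAdd α (finProdFinEquiv (j, r))

theorem divNat_finProdFinEquiv {β : ℕ} (j : Fin β) (r : Fin 2) :
    (finProdFinEquiv (j, r)).divNat = j :=
  congrArg Prod.fst (finProdFinEquiv.symm_apply_apply (j, r))

theorem modNat_finProdFinEquiv {β : ℕ} (j : Fin β) (r : Fin 2) :
    (finProdFinEquiv (j, r)).modNat = r :=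
  congrArg Prod.snd (finProdFinEquiv.symm_apply_apply (j, r))

@[simp] theorem partner_castAdd {α β : ℕ} (i : Fin α) :
    partner α β (Fin.castAdd (β * 2) i) = Fin.castAdd (β * 2) i := by
  simp [partner]

@[simp] theorem partner_quatPos {α β : ℕ} (j : Fin β) (r : Fin 2) :
    partner α β (quatPos j r) = quatPos j (r + 1) := by
  simp [partner, quatPos, divNat_finProdFinEquiv, modNat_finProdFinEquiv]

@[simp] theorem gray_castAdd {α β : ℕ} (x : MixedWord α β) (i : Fin α) :
    gray x (Fin.castAdd (β * 2) i) = x.1 i := by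
  simp [gray]

@[simp] theorem gray_quatPos {α β : ℕ} (x : MixedWord α β) (j : Fin β) (r : Fin 2) :
    gray x (quatPos j r) = grayDigit (x.2 j) r := by
  simp [gray, quatPos, divNat_finProdFinEquiv, modNat_finProdFinEquiv]

theorem quatPos_inj {α β : ℕ} {j k : Fin β} {r s : Fin 2}
    (h : (quatPos j r : Fin (α + β * 2)) = quatPos k s) : j = k ∧ r = s := by
  have := finProdFinEquiv.injective (Fin.natAdd_injective _ _ h)
  simpa using this

theorem castAdd_ne_quatPos {α β : ℕ} (i : Fin α) (j : Fin β) (r : Fin 2) :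
    Fin.castAdd (β * 2) i ≠ quatPos j r := by
  intro h
  have := congrArg Fin.val h
  simp [quatPos] at this
  omega

/-- Every coordinate is binary or one of the two replacing a quaternary coordinate. -/
theorem castAdd_or_quatPos {α β : ℕ} (i : Fin (α + β * 2)) :
    (∃ k : Fin α, i = Fin.castAdd (β * 2) k) ∨ ∃ (j : Fin β) (r : Fin 2), i = quatPos j r := by
  induction i using Fin.addCases with
  | left i => exact Or.inl ⟨i, rfl⟩
  | right k =>
    refine Or.inr ⟨k.divNat, k.modNat, ?_⟩
    exact congrArg (Fin.natAdd α) (finProdFinEquiv.apply_symm_apply k).symm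

theorem fin_two_add_one_add_one (r : Fin 2) : r + 1 + 1 = r := by
  revert r; decide

theorem fin_two_ne_add_one (r : Fin 2) : r ≠ r + 1 := by
  revert r; decide

theorem partner_involutive (α β : ℕ) : Function.Involutive (partner α β) := by
  intro i
  rcases castAdd_or_quatPos i with ⟨k, rfl⟩ | ⟨j, r, rfl⟩ <;> simp [fin_two_add_one_add_one]

/-- The addition of the mixed group, transported to binary words. -/
def twistedAdd {n : ℕ} (m : Fin n → Fin n) (x y : BinWord n) : BinWord n :=
  fun i => x i + y i + (x i + x (m i)) * (y i + y (m i))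

/-- The two Gray bits of a digit differ exactly when it is odd, so the product is the correction
needed when both digits are odd. -/
theorem grayDigit_add (p q : ZMod 4) (r : Fin 2) :
    grayDigit (p + q) r = grayDigit p r + grayDigit q r +
      (grayDigit p r + grayDigit p (r + 1)) * (grayDigit q r + grayDigit q (r + 1)) := by
  revert p q r; decide

theorem gray_add {α β : ℕ} (x y : MixedWord α β) :
    gray (x + y) = twistedAdd (partner α β) (gray x) (gray y) := by
  funext i
  rcases castAdd_or_quatPos i with ⟨k, rfl⟩ | ⟨j, r, rfl⟩
  · simp [twistedAdd, CharTwo.add_self_eq_zero]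
  · simp [twistedAdd, grayDigit_add]

theorem grayDigit_injective : Function.Injective grayDigit := by
  intro p q; revert p q; decide

theorem gray_injective {α β : ℕ} : Function.Injective (gray (α := α) (β := β)) := by
  intro x y h
  refine Prod.ext (funext fun i => ?_) (funext fun j => grayDigit_injective (funext fun r => ?_))
  · simpa using congrFun h (Fin.castAdd (β * 2) i)
  · simpa using congrFun h (quatPos j r)

theorem gray_zero {α β : ℕ} : gray (0 : MixedWord α β) = 0 := by
  funext i
  rcases castAdd_or_quatPos i with ⟨k, rfl⟩ | ⟨j, r, rfl⟩
  · simp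
  · simp only [gray_quatPos, Prod.snd_zero, Pi.zero_apply]
    revert r; decide

theorem IsAdditive.zero_mem {α β : ℕ} {C : Set (MixedWord α β)} (hC : IsAdditive C)
    (hne : C.Nonempty) : 0 ∈ C := by
  obtain ⟨x, hx⟩ := hne
  have h2 := hC x hx x hx
  have h4 := hC _ h2 _ h2
  have : x + x + (x + x) = 0 := by
    refine Prod.ext (funext fun i => ?_) (funext fun j => ?_)
    · simp [CharTwo.add_self_eq_zero]
    · simp only [Prod.snd_add, Pi.add_apply, Prod.snd_zero, Pi.zero_apply]
      generalize x.2 j = p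
      revert p; decide
  rwa [this] at h4

theorem fin_two_eq_or (r : Fin 2) : r = 0 ∨ r = 1 := by revert r; decide

theorem grayDigit_neg (p : ZMod 4) (r : Fin 2) : grayDigit (-p) r = grayDigit p (r + 1) := by
  revert p r; decide

/-- A bijection of coordinates that commutes with the partner involutions comes from a monomial
transformation. -/
theorem monomiallyEquivalent_of_partner {α β α' β' : ℕ} {C : Set (MixedWord α β)}
    {D : Set (MixedWord α' β')} (σ : Fin (α + β * 2) ≃ Fin (α' + β' * 2))
    (hσ : ∀ i, σ (partner α β i) = partner α' β' (σ i))
    (hCD : permute σ '' (gray '' C) = gray '' D) : MonomiallyEquivalent C D := by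
  have h1 : ∀ i : Fin α, ∃ k : Fin α', σ (Fin.castAdd (β * 2) i) = Fin.castAdd (β' * 2) k := by
    intro i
    rcases castAdd_or_quatPos (σ (Fin.castAdd (β * 2) i)) with h | ⟨j, r, h⟩
    · exact h
    · have := hσ (Fin.castAdd (β * 2) i)
      rw [partner_castAdd, h, partner_quatPos] at this
      exact absurd (quatPos_inj this).2 (fin_two_ne_add_one r)
  have h2 : ∀ j : Fin β, ∃ (k : Fin β') (s : Fin 2), σ (quatPos j 0) = quatPos k s := by
    intro j
    rcases castAdd_or_quatPos (σ (quatPos j 0)) with ⟨i, h⟩ | h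
    · have := hσ (quatPos j 0)
      rw [h, partner_castAdd, ← h, partner_quatPos] at this
      exact absurd (quatPos_inj (σ.injective this)).2.symm (fin_two_ne_add_one 0)
    · exact h
  choose ρ hρ using h1
  choose τ s hτ using h2
  have hτ' : ∀ j r, σ (quatPos j r) = quatPos (τ j) (s j + r) := by
    intro j r
    rcases fin_two_eq_or r with rfl | rfl
    · simp [hτ]
    · have := hσ (quatPos j 0)
      rw [hτ, partner_quatPos, partner_quatPos] at this
      simpa using this
  have hρb : Function.Bijective ρ := by
    constructor
    · intro i i' h
      have : σ (Fin.castAdd (β * 2) i) = σ (Fin.castAdd (β * 2) i') := by rw [hρ, hρ, h]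
      exact Fin.castAdd_injective _ _ (σ.injective this)
    · intro k
      obtain ⟨i, hi⟩ := σ.surjective (Fin.castAdd (β' * 2) k)
      rcases castAdd_or_quatPos i with ⟨i, rfl⟩ | ⟨j, r, rfl⟩
      · exact ⟨i, Fin.castAdd_injective _ _ ((hρ i).symm.trans hi)⟩
      · rw [hτ'] at hi
        exact absurd hi.symm (castAdd_ne_quatPos _ _ _)
  have hτb : Function.Bijective τ := by
    constructor
    · intro j j' h
      -- The offsets `s j` and `s j'` cancel themselves modulo 2: both sides are bit 0 of the same
      -- pair.
      have : σ (quatPos j (s j)) = σ (quatPos j' (s j')) := by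
        rw [hτ', hτ', h]
        congr 1
        generalize s j = p
        generalize s j' = q
        revert p q; decide
      exact (quatPos_inj (σ.injective this)).1
    · intro k
      obtain ⟨i, hi⟩ := σ.surjective (quatPos k 0)
      rcases castAdd_or_quatPos i with ⟨i, rfl⟩ | ⟨j, r, rfl⟩
      · rw [hρ] at hi
        exact absurd hi (castAdd_ne_quatPos _ _ _)
      · rw [hτ'] at hi
        exact ⟨j, (quatPos_inj hi).1⟩
  let R := Equiv.ofBijective ρ hρb
  let T := Equiv.ofBijective τ hτb
  -- Negating a digit swaps its Gray bits, so the sign records whether `σ` reverses the pair.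
  let ε : Fin β' → ℤˣ := fun k => if s (T.symm k) = 0 then 1 else -1
  have hgray : ∀ x, gray (monomial R T ε x) = permute σ (gray x) := by
    intro x
    funext i
    obtain ⟨i, rfl⟩ := σ.surjective i
    simp only [permute, Equiv.symm_apply_apply]
    rcases castAdd_or_quatPos i with ⟨i, rfl⟩ | ⟨j, r, rfl⟩
    · rw [hρ]
      have : R.symm (ρ i) = i := R.symm_apply_apply i
      simp [monomial, this]
    · rw [hτ']
      have : T.symm (τ j) = j := T.symm_apply_apply j
      simp only [monomial, gray_quatPos, this, ε]
      rcases fin_two_eq_or (s j) with h | h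
      · simp [h]
      · simp only [h, one_ne_zero, if_false, Units.neg_smul, one_smul, grayDigit_neg]
        congr 1
        revert r; decide
  refine ⟨R, T, ε, gray_injective.image_injective ?_⟩
  rw [← hCD, Set.image_image, Set.image_image]
  simp only [hgray]

/-! ### Light codewords and uniqueness of the involution. -/

/-- The support of a binary word. -/
def support {n : ℕ} (x : BinWord n) : Finset (Fin n) := Finset.univ.filter fun i => x i = 1

theorem mem_support {n : ℕ} {x : BinWord n} {i : Fin n} : i ∈ support x ↔ x i = 1 := by
  simp [support]

theorem zmod_two_eq_zero_of_ne_one {p : ZMod 2} : p ≠ 1 → p = 0 := by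
  revert p; decide

theorem zmod_two_ne_iff (p q : ZMod 2) : p ≠ q ↔ p = 1 ∧ ¬q = 1 ∨ q = 1 ∧ ¬p = 1 := by
  revert p q; decide

theorem support_injective {n : ℕ} : Function.Injective (support (n := n)) := by
  intro x y h
  funext i
  have := Finset.ext_iff.1 h i
  rw [mem_support, mem_support] at this
  revert this
  generalize x i = p
  generalize y i = q
  revert p q; decide

theorem support_zero {n : ℕ} : support (0 : BinWord n) = ∅ := by
  simp [support]

theorem hammingDist_eq_card_symmDiff {n : ℕ} (x y : BinWord n) :
    hammingDist x y = (symmDiff (support x) (support y)).card := by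
  unfold hammingDist
  congr 1
  ext i
  rw [Finset.mem_symmDiff, mem_support, mem_support, Finset.mem_filter_univ]
  exact zmod_two_ne_iff (x i) (y i)

theorem HasMinDist.mono {n : ℕ} {E : Set (BinWord n)} {d e : ℕ} (h : HasMinDist E d)
    (hed : e ≤ d) : HasMinDist E e :=
  fun x hx y hy hne => hed.trans (h x hx y hy hne)

/-- Every coordinate is covered by a light codeword avoiding a prescribed small set. -/
theorem exists_light_codeword {n : ℕ} {E : Set (BinWord n)} (hn : 16 < n) (h0 : 0 ∈ E)
    (hE : IsOnePerfect E ∨ IsExtendedOnePerfect E ∨ IsPreparataLike E) :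
    HasMinDist E 3 ∧ ∃ w, 1 ≤ w ∧ ∀ (a : Fin n) (F : Finset (Fin n)), a ∉ F →
      F.card + 1 ≤ 3 * w →
      ∃ x ∈ E, x a = 1 ∧ (∀ i ∈ F, x i = 0) ∧ (support x).card ≤ w := by
  classical
  set G : Finset (Finset (Fin n)) := (Set.toFinite E).toFinset.image support with hG
  have hmem : ∀ s, s ∈ G ↔ ∃ x ∈ E, support x = s := by simp [hG]
  have hcard : G.card = E.ncard := by
    rw [hG, Finset.card_image_of_injective _ support_injective, ← Set.ncard_eq_toFinset_card]
  have hG0 : ∅ ∈ G := (hmem _).2 ⟨0, h0, support_zero⟩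
  have hdist : ∀ d, HasMinDist E d → FamilyDist G d := by
    intro d hd s hs t ht hne
    obtain ⟨x, hx, rfl⟩ := (hmem s).1 hs
    obtain ⟨y, hy, rfl⟩ := (hmem t).1 ht
    rw [← hammingDist_eq_card_symmDiff]
    exact hd x hx y hy fun h => hne (h ▸ rfl)
  have hword : ∀ (w : ℕ) (a : Fin n) (F : Finset (Fin n)),
      (∃ c ∈ G, a ∈ c ∧ Disjoint c F ∧ c.card ≤ w) →
      ∃ x ∈ E, x a = 1 ∧ (∀ i ∈ F, x i = 0) ∧ (support x).card ≤ w := by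
    rintro w a F ⟨c, hc, hac, hcF, hcw⟩
    obtain ⟨x, hx, rfl⟩ := (hmem c).1 hc
    exact ⟨x, hx, mem_support.1 hac, fun i hi => zmod_two_eq_zero_of_ne_one fun h =>
      Finset.disjoint_left.1 hcF (mem_support.2 h) hi, hcw⟩
  rw [← Fintype.card_fin n] at hn
  rcases hE with ⟨hc, hd⟩ | ⟨hc, hd⟩ | ⟨hc, hd⟩
  · refine ⟨hd, 3, by norm_num, fun a F haF hF => hword 3 a F ?_⟩
    exact exists_light_of_perfect (by simpa [hcard] using hc) (hdist 3 hd) hG0 hn a F haF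
      (by omega)
  · refine ⟨hd.mono (by norm_num), 4, by norm_num, fun a F haF hF => hword 4 a F ?_⟩
    exact exists_light_of_extended_perfect (by simpa [hcard] using hc) (hdist 4 hd) hG0 hn a F haF
      (by omega)
  · refine ⟨hd.mono (by norm_num), 6, by norm_num, fun a F haF hF => hword 6 a F ?_⟩
    exact exists_light_of_preparata (by simpa [hcard] using hc) (hdist 6 hd) hG0 hn a F haF
      (by omega)

/-- The correction term of the twisted addition for two words that meet only in `a`. -/
theorem twist_eq_ite {n : ℕ} {m : Fin n → Fin n} (hm : Function.Involutive m) {x y : BinWord n}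
    {a : Fin n} (hxa : x a = 1) (hya : y a = 1) (hx : m a ≠ a → x (m a) = 0)
    (hy : m a ≠ a → y (m a) = 0) (hxy : ∀ i, i ≠ a → x i = 1 → y i = 0)
    (hxy' : ∀ i, i ≠ a → m i ≠ a → x i = 1 → y (m i) = 0) (i : Fin n) :
    (x i + x (m i)) * (y i + y (m i)) = if m a ≠ a ∧ (i = a ∨ i = m a) then 1 else 0 := by
  by_cases ha : m a = a
  · rw [if_neg (by simp [ha])]
    by_cases hi : i = a
    · simp [hi, ha, CharTwo.add_self_eq_zero]
    · have hmi : m i ≠ a := fun h => hi (by rw [← hm i, h, ha])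
      by_cases h1 : x i = 1
      · simp [hxy i hi h1, hxy' i hi hmi h1]
      · by_cases h2 : x (m i) = 1
        · have := hxy' (m i) hmi (by rwa [hm i]) h2
          rw [hm i] at this
          simp [this, hxy (m i) hmi h2]
        · simp [zmod_two_eq_zero_of_ne_one h1, zmod_two_eq_zero_of_ne_one h2]
  · by_cases hi : i = a
    · simp [hi, ha, hxa, hya, hx ha, hy ha]
    by_cases hi' : i = m a
    · simp [hi', ha, hxa, hya, hx ha, hy ha, hm a]
    · rw [if_neg (by tauto)]
      have hmi : m i ≠ a := fun h => hi' (by rw [← h, hm i])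
      by_cases h1 : x i = 1
      · simp [hxy i hi h1, hxy' i hi hmi h1]
      · by_cases h2 : x (m i) = 1
        · have := hxy' (m i) hmi (by rwa [hm i]) h2
          rw [hm i] at this
          simp [this, hxy (m i) hmi h2]
        · simp [zmod_two_eq_zero_of_ne_one h1, zmod_two_eq_zero_of_ne_one h2]

/-- A code with many light codewords is closed under at most one twisted addition. -/
theorem involution_unique {n : ℕ} {E : Set (BinWord n)} (hn : 16 < n) (h0 : 0 ∈ E)
    (hE : IsOnePerfect E ∨ IsExtendedOnePerfect E ∨ IsPreparataLike E)
    {m m' : Fin n → Fin n} (hm : Function.Involutive m) (hm' : Function.Involutive m')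
    (hadd : ∀ x ∈ E, ∀ y ∈ E, twistedAdd m x y ∈ E)
    (hadd' : ∀ x ∈ E, ∀ y ∈ E, twistedAdd m' x y ∈ E) : m = m' := by
  classical
  obtain ⟨hd, w, hw, hlight⟩ := exists_light_codeword hn h0 hE
  funext a
  by_contra hne
  obtain ⟨x, hxE, hxa, hxF, hxw⟩ := hlight a (({m a, m' a} : Finset (Fin n)).erase a) (by simp) (by
    have := (Finset.card_erase_le (s := {m a, m' a}) (a := a)).trans Finset.card_le_two
    omega)
  set X := (support x).erase a with hX
  have hXw : X.card + 1 ≤ w := by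
    rw [hX, Finset.card_erase_add_one (mem_support.2 hxa)]
    exact hxw
  -- The forbidden set has at most 2 + 3(w - 1) = 3w - 1 elements, exactly what `hlight` allows.
  obtain ⟨y, hyE, hya, hyF, -⟩ := hlight a
    (({m a, m' a} ∪ (X ∪ (X.image m ∪ X.image m'))).erase a) (by simp) (by
      have h1 := Finset.card_erase_le (s := {m a, m' a} ∪ (X ∪ (X.image m ∪ X.image m'))) (a := a)
      have h2 := Finset.card_union_le {m a, m' a} (X ∪ (X.image m ∪ X.image m'))
      have h3 := Finset.card_union_le X (X.image m ∪ X.image m')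
      have h4 := Finset.card_union_le (X.image m) (X.image m')
      have h5 : (X.image m).card ≤ X.card := Finset.card_image_le
      have h6 : (X.image m').card ≤ X.card := Finset.card_image_le
      have h7 : ({m a, m' a} : Finset (Fin n)).card ≤ 2 := Finset.card_le_two
      omega)
  have hmemX : ∀ i, i ≠ a → x i = 1 → i ∈ X := fun i hi h =>
    Finset.mem_erase.2 ⟨hi, mem_support.2 h⟩
  have hxy : ∀ i, i ≠ a → x i = 1 → y i = 0 := fun i hi h =>
    hyF i (by simp [hi, hmemX i hi h])
  have t1 := twist_eq_ite hm hxa hya (fun h => hxF _ (by simp [h])) (fun h => hyF _ (by simp [h]))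
    hxy fun i hi hmi h => hyF _ (Finset.mem_erase.2 ⟨hmi, Finset.mem_union_right _
      (Finset.mem_union_right _ (Finset.mem_union_left _
        (Finset.mem_image_of_mem m (hmemX i hi h))))⟩)
  have t2 := twist_eq_ite hm' hxa hya (fun h => hxF _ (by simp [h])) (fun h => hyF _ (by simp [h]))
    hxy fun i hi hmi h => hyF _ (Finset.mem_erase.2 ⟨hmi, Finset.mem_union_right _
      (Finset.mem_union_right _ (Finset.mem_union_right _
        (Finset.mem_image_of_mem m' (hmemX i hi h))))⟩)
  -- If neither involution fixes `a`, the two corrections at `a` cancel. If one fixes `a`, it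
  -- contributes no correction, and the surviving one at `a` sits at its image of `a`.
  have hdiff : ∀ i, twistedAdd m x y i ≠ twistedAdd m' x y i ↔ i = m a ∨ i = m' a := by
    intro i
    simp only [twistedAdd, t1, t2, ne_eq, add_right_inj]
    split_ifs <;> simp <;> grind
  have h3 := hd _ (hadd x hxE y hyE) _ (hadd' x hxE y hyE)
    (fun h => (hdiff (m a)).2 (Or.inl rfl) (congrFun h (m a)))
  have h2 : hammingDist (twistedAdd m x y) (twistedAdd m' x y) ≤ 2 := by
    refine le_trans (Finset.card_le_card fun i hi => ?_)
      (Finset.card_le_two (a := m a) (b := m' a))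
    rw [Finset.mem_filter] at hi
    simpa using (hdiff i).1 hi.2
  omega

/-! ### Transport along a coordinate bijection and conclusion. -/

theorem permute_twistedAdd {k n : ℕ} (σ : Fin k ≃ Fin n) (m : Fin n → Fin n) (x y : BinWord k) :
    permute σ (twistedAdd (fun i => σ.symm (m (σ i))) x y) =
      twistedAdd m (permute σ x) (permute σ y) := by
  funext i
  simp [permute, twistedAdd]

theorem permute_injective {k n : ℕ} (σ : Fin k ≃ Fin n) : Function.Injective (permute σ) := by
  intro x y h
  funext i
  simpa [permute] using congrFun h (σ i)

theorem IsAdditive.twistedAdd_mem {α β : ℕ} {C : Set (MixedWord α β)} (hC : IsAdditive C) :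
    ∀ x ∈ gray '' C, ∀ y ∈ gray '' C, twistedAdd (partner α β) x y ∈ gray '' C := by
  rintro _ ⟨x, hx, rfl⟩ _ ⟨y, hy, rfl⟩
  exact ⟨x + y, hC x hx y hy, gray_add x y⟩

theorem nonempty_of_isOnePerfect_or {n : ℕ} {E : Set (BinWord n)}
    (hE : IsOnePerfect E ∨ IsExtendedOnePerfect E ∨ IsPreparataLike E) : E.Nonempty := by
  rw [Set.nonempty_iff_ne_empty]
  rintro rfl
  have hpos : ∀ k : ℕ, 0 ≠ 2 ^ k := fun k => (pow_pos two_pos k).ne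
  simp [IsOnePerfect, IsExtendedOnePerfect, IsPreparataLike, hpos] at hE

end Z2Z4

theorem corollary3 {α β α' β' : ℕ}
    (C : Set (Z2Z4.MixedWord α β)) (D : Set (Z2Z4.MixedWord α' β'))
    (hC : Z2Z4.IsAdditive C) (hD : Z2Z4.IsAdditive D)
    (hlen : 16 < α + β * 2)
    (hC' : Z2Z4.IsOnePerfect (Z2Z4.gray '' C) ∨ Z2Z4.IsExtendedOnePerfect (Z2Z4.gray '' C) ∨
      Z2Z4.IsPreparataLike (Z2Z4.gray '' C))
    (hD' : Z2Z4.IsOnePerfect (Z2Z4.gray '' D) ∨ Z2Z4.IsExtendedOnePerfect (Z2Z4.gray '' D) ∨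
      Z2Z4.IsPreparataLike (Z2Z4.gray '' D))
    (hne : ¬ Z2Z4.MonomiallyEquivalent C D) :
    ¬ Z2Z4.PermEquivalent (Z2Z4.gray '' C) (Z2Z4.gray '' D) := by
  rintro ⟨σ, hσ⟩
  refine hne (Z2Z4.monomiallyEquivalent_of_partner σ (fun i => ?_) hσ)
  have h0 : (0 : Z2Z4.BinWord (α + β * 2)) ∈ Z2Z4.gray '' C :=
    ⟨0, hC.zero_mem (Set.image_nonempty.1 (Z2Z4.nonempty_of_isOnePerfect_or hC')),
      Z2Z4.gray_zero⟩
  -- The second involution is the pairing of the target code, conjugated by `σ`; equality of the two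
  -- says that `σ` commutes with the pairings.
  have hm := Z2Z4.involution_unique hlen h0 hC' (Z2Z4.partner_involutive α β)
    (m' := fun i => σ.symm (Z2Z4.partner α' β' (σ i)))
    (fun i => by simp [Z2Z4.partner_involutive α' β' (σ i)]) hC.twistedAdd_mem
    (fun x hx y hy => by
      rw [← (Z2Z4.permute_injective σ).mem_set_image, Z2Z4.permute_twistedAdd, hσ]
      exact hD.twistedAdd_mem _ (hσ ▸ Set.mem_image_of_mem _ hx) _
        (hσ ▸ Set.mem_image_of_mem _ hy))
  rw [hm]
  simp
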